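/- Let $D$ be a finite directed graph. A knot of $D$ is a strongly connected component with at least two vertices such that no arc of $D$ leads from a vertex of the component to a vertex outside it; $D$ is knot-free if it has no knot. A knot-free vertex deletion set of $D$ is a set $S\subseteq V(D)$ such that $D-S$ (the subgraph induced on $V(D)\setminus S$) is knot-free. Theorem. The number of inclusion-wise minimal knot-free vertex deletion sets of an $n$-vertex digraph is $\mathcal{O}^*(1.4549^n)$. That is, there is a polynomial $p$ such that, for every $n\ge 0$, every digraph on $n$ vertices has at most $p(n)\cdot 1.4549^n$ inclusion-wise minimal knot-free vertex deletion sets. -/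

import Mathlib

/-!
In a finite digraph every vertex reaches a terminal strong component, so `D - S` is knot-free iff
each of its vertices reaches a sink. Hence a minimal deletion set `S` is exactly the union of the
out-neighbourhoods of the sinks of `D - S`, and it is determined by these sinks.

If `z` is a sink of `D - S`, the out-neighbours of `z` lie in `S`, while minimality keeps every
vertex that reaches `z` in `D - N⁺(z)` out of `S`; none of those vertices other than `z` is a sink,
as it still reaches `z` in `D - S`. So the sinks form a maximal independent set of the graph joining
`u` to `z` whenever `u ∈ N⁺(z)` or `u` reaches `z` in `D - N⁺(z)`, and by Moon and Moser a graph on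
`n` vertices has at most `3 ^ (n / 3)` maximal independent sets.
-/

namespace KnotFree

variable {V : Type*}

/-- `K` is (the vertex set of) a strongly connected component of `D`: a class of the relation
"there are directed paths from `u` to `v` and from `v` to `u`". -/
def IsStronglyConnectedComponent (D : Digraph V) (K : Set V) : Prop :=
  K.Nonempty ∧ ∀ u ∈ K, ∀ v, v ∈ K ↔
    (Relation.ReflTransGen D.Adj u v ∧ Relation.ReflTransGen D.Adj v u)

/-- A knot: a strongly connected component with at least two vertices and no arc leaving it. -/
def IsKnot (D : Digraph V) (K : Set V) : Prop :=
  IsStronglyConnectedComponent D K ∧ K.Nontrivial ∧ ∀ u ∈ K, ∀ v, v ∉ K → ¬ D.Adj u v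

/-- A digraph is knot-free if it contains no knot. -/
def IsKnotFree (D : Digraph V) : Prop :=
  ∀ K : Set V, ¬ IsKnot D K

/-- The digraph `D - S`, that is, the subgraph of `D` induced on the vertices outside `S`. -/
def deleteVerts (D : Digraph V) (S : Set V) : Digraph {v : V // v ∉ S} where
  Adj u v := D.Adj u.1 v.1

/-- `S` is a knot-free vertex deletion set of `D` if `D - S` is knot-free. -/
def IsDeletionSet (D : Digraph V) (S : Set V) : Prop :=
  IsKnotFree (deleteVerts D S)

/-- The family of inclusion-wise minimal knot-free vertex deletion sets of `D`. -/
def minimalDeletionSets (D : Digraph V) : Set (Set V) :=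
  {S | Minimal (IsDeletionSet D) S}

end KnotFree

namespace KnotFree

open Relation SimpleGraph

section MoonMoser

variable {V : Type*} {G : SimpleGraph V} {W I : Set V} {u v : V}

lemma isIndepSet_insert :
    G.IsIndepSet (insert v I) ↔ G.IsIndepSet I ∧ ∀ u ∈ I, ¬ G.Adj v u := by
  rw [← isClique_compl, isClique_insert, isClique_compl]
  refine and_congr_right fun _ => forall₂_congr fun u _ => ?_
  rw [compl_adj]
  exact ⟨fun h hvu => (h hvu.ne).2 hvu, fun h hne => ⟨hne, h⟩⟩

lemma maximal_isIndepSet_of_forall_exists_adj (hI : G.IsIndepSet I)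
    (hdom : ∀ v ∉ I, ∃ u ∈ I, G.Adj v u) : Maximal G.IsIndepSet I := by
  refine ⟨hI, fun J hJ hIJ v hvJ => ?_⟩
  by_contra hvI
  obtain ⟨u, huI, hvu⟩ := hdom v hvI
  exact hJ hvJ (hIJ huI) hvu.ne hvu

/-- The closed neighbourhood `N[v]`: the vertex `v` together with its neighbours. -/
def closedNbhd (G : SimpleGraph V) (v : V) : Set V :=
  insert v (G.neighborSet v)

/-- `I` is an independent set of the subgraph of `G` induced on `W`. -/
def IsIndepSetIn (G : SimpleGraph V) (W I : Set V) : Prop :=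
  I ⊆ W ∧ G.IsIndepSet I

/-- The family of maximal independent sets of the subgraph of `G` induced on `W`. -/
def maximalIndepSets (G : SimpleGraph V) (W : Set V) : Set (Set V) :=
  {I | Maximal (IsIndepSetIn G W) I}

lemma finite_maximalIndepSets (G : SimpleGraph V) (hW : W.Finite) :
    (maximalIndepSets G W).Finite :=
  hW.finite_subsets.subset fun _ ⟨hI, _⟩ => hI.1

lemma exists_mem_inter_closedNbhd (hI : Maximal (IsIndepSetIn G W) I) (hv : v ∈ W) :
    ∃ u ∈ W ∩ closedNbhd G v, u ∈ I := by
  by_cases hvI : v ∈ I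
  · exact ⟨v, ⟨hv, Set.mem_insert _ _⟩, hvI⟩
  by_contra! hno
  refine hvI (hI.mem_of_prop_insert ⟨Set.insert_subset hv hI.prop.1, ?_⟩)
  exact isIndepSet_insert.2 ⟨hI.prop.2, fun u hu hvu =>
    hno u ⟨hI.prop.1 hu, Set.mem_insert_of_mem _ hvu⟩ hu⟩

lemma maximal_isIndepSetIn_sdiff_singleton (hI : Maximal (IsIndepSetIn G W) I) (hu : u ∈ I) :
    Maximal (IsIndepSetIn G (W \ closedNbhd G u)) (I \ {u}) := by
  refine ⟨⟨fun w hw => ⟨hI.prop.1 hw.1, ?_⟩, hI.prop.2.mono Set.sdiff_subset⟩, ?_⟩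
  · rintro (rfl | huw)
    · exact hw.2 rfl
    · exact hI.prop.2 hu hw.1 (G.ne_of_adj huw) huw
  · rintro J ⟨hJW, hJ⟩ hIJ
    have hindep : G.IsIndepSet (insert u J) :=
      isIndepSet_insert.2 ⟨hJ, fun w hw huw => (hJW hw).2 (Set.mem_insert_of_mem _ huw)⟩
    have hsub : insert u J ⊆ I :=
      hI.le_of_ge ⟨Set.insert_subset (hI.prop.1 hu) fun w hw => (hJW hw).1, hindep⟩
        (Set.sdiff_singleton_subset_iff.1 hIJ)
    refine fun w hw => ⟨hsub (Set.mem_insert_of_mem _ hw), ?_⟩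
    rintro rfl
    exact (hJW hw).2 (Set.mem_insert _ _)

lemma ncard_maximalIndepSets_mem_le (G : SimpleGraph V) (hW : W.Finite) (u : V) :
    {I ∈ maximalIndepSets G W | u ∈ I}.ncard ≤
      (maximalIndepSets G (W \ closedNbhd G u)).ncard := by
  refine Set.ncard_le_ncard_of_injOn (fun I => I \ {u})
    (fun I hI => maximal_isIndepSetIn_sdiff_singleton hI.1 hI.2) (fun I hI J hJ hIJ => ?_)
    (finite_maximalIndepSets G hW.sdiff)
  rw [← Set.insert_sdiff_self_of_mem hI.2, ← Set.insert_sdiff_self_of_mem hJ.2]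
  exact congrArg (insert u) hIJ

lemma exists_ncard_maximalIndepSets_le_mul (hW : W.Finite) (hv : v ∈ W) :
    ∃ u ∈ W, (maximalIndepSets G W).ncard ≤
      (W ∩ closedNbhd G v).ncard * (maximalIndepSets G (W \ closedNbhd G u)).ncard := by
  have hN : (W ∩ closedNbhd G v).Finite := hW.inter_of_left _
  obtain ⟨u, hu, hmax⟩ := Set.exists_max_image _
    (fun u => (maximalIndepSets G (W \ closedNbhd G u)).ncard) hN ⟨v, hv, Set.mem_insert _ _⟩
  have hcover : maximalIndepSets G W ⊆
      ⋃ w ∈ hN.toFinset, {I ∈ maximalIndepSets G W | w ∈ I} := fun I hI => by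
    obtain ⟨w, hw, hwI⟩ := exists_mem_inter_closedNbhd hI hv
    exact Set.mem_biUnion (hN.mem_toFinset.2 hw) ⟨hI, hwI⟩
  have hfin : (⋃ w ∈ hN.toFinset, {I ∈ maximalIndepSets G W | w ∈ I}).Finite :=
    (finite_maximalIndepSets G hW).subset (Set.iUnion₂_subset fun w _ => Set.sep_subset _ _)
  refine ⟨u, hu.1, ?_⟩
  calc (maximalIndepSets G W).ncard
      ≤ ∑ w ∈ hN.toFinset, {I ∈ maximalIndepSets G W | w ∈ I}.ncard :=
        (Set.ncard_le_ncard hcover hfin).trans (Finset.set_ncard_biUnion_le _ _)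
    _ ≤ hN.toFinset.card • (maximalIndepSets G (W \ closedNbhd G u)).ncard :=
        Finset.sum_le_card_nsmul _ _ _ fun w hw =>
          (ncard_maximalIndepSets_mem_le G hW w).trans (hmax w (hN.mem_toFinset.1 hw))
    _ = (W ∩ closedNbhd G v).ncard * (maximalIndepSets G (W \ closedNbhd G u)).ncard := by
        rw [smul_eq_mul, Set.ncard_eq_toFinset_card _ hN]

lemma pow_three_le_three_pow (k : ℕ) : k ^ 3 ≤ 3 ^ k := by
  rcases lt_or_ge k 3 with hk | hk
  · interval_cases k <;> norm_num
  · induction k, hk using Nat.le_induction with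
    | base => norm_num
    | succ k hk ih =>
      have hstep : (k + 1) ^ 3 ≤ k ^ 3 * 3 := by nlinarith [Nat.mul_le_mul hk hk]
      exact hstep.trans (Nat.mul_le_mul_right 3 ih)

theorem ncard_maximalIndepSets_pow_three_le (G : SimpleGraph V) (hW : W.Finite) :
    (maximalIndepSets G W).ncard ^ 3 ≤ 3 ^ W.ncard := by
  induction hn : W.ncard using Nat.strong_induction_on generalizing W with
  | _ n ih =>
  subst hn
  rcases W.eq_empty_or_nonempty with rfl | hne
  · have hsub : maximalIndepSets G ∅ ⊆ {∅} := fun I ⟨hI, _⟩ => Set.subset_empty_iff.1 hI.1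
    have hle : (maximalIndepSets G ∅).ncard ≤ 1 := by
      simpa only [Set.ncard_singleton] using Set.ncard_le_ncard hsub
    simpa only [Set.ncard_empty, pow_zero, one_pow] using Nat.pow_le_pow_left hle 3
  obtain ⟨v, hv, hmin⟩ :=
    Set.exists_min_image W (fun u => (W ∩ closedNbhd G u).ncard) hW hne
  obtain ⟨u, hu, hle⟩ := exists_ncard_maximalIndepSets_le_mul (G := G) hW hv
  have hlt : (W \ closedNbhd G u).ncard < W.ncard :=
    Set.ncard_lt_ncard ⟨Set.sdiff_subset, fun h => (h hu).2 (Set.mem_insert _ _)⟩ hW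
  have hsplit : (W ∩ closedNbhd G v).ncard + (W \ closedNbhd G u).ncard ≤ W.ncard :=
    (Nat.add_le_add_right (hmin u hu) _).trans
      (Set.ncard_inter_add_ncard_sdiff_eq_ncard W (closedNbhd G u) hW).le
  calc (maximalIndepSets G W).ncard ^ 3
      ≤ ((W ∩ closedNbhd G v).ncard * (maximalIndepSets G (W \ closedNbhd G u)).ncard) ^ 3 :=
        Nat.pow_le_pow_left hle 3
    _ = (W ∩ closedNbhd G v).ncard ^ 3 *
          (maximalIndepSets G (W \ closedNbhd G u)).ncard ^ 3 := mul_pow _ _ _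
    _ ≤ 3 ^ (W ∩ closedNbhd G v).ncard * 3 ^ (W \ closedNbhd G u).ncard :=
        Nat.mul_le_mul (pow_three_le_three_pow _) (ih _ hlt hW.sdiff rfl)
    _ = 3 ^ ((W ∩ closedNbhd G v).ncard + (W \ closedNbhd G u).ncard) := (pow_add _ _ _).symm
    _ ≤ 3 ^ W.ncard := Nat.pow_le_pow_right three_pos hsplit

/-- The **Moon–Moser bound** `3 ^ (n / 3)`, cubed to stay within the natural numbers. -/
theorem ncard_maximal_isIndepSet_pow_three_le [Finite V] (G : SimpleGraph V) :
    {I | Maximal G.IsIndepSet I}.ncard ^ 3 ≤ 3 ^ Nat.card V := by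
  have huniv : IsIndepSetIn G Set.univ = G.IsIndepSet :=
    funext fun I => propext (and_iff_right (Set.subset_univ I))
  simpa only [maximalIndepSets, huniv, Set.ncard_univ] using
    ncard_maximalIndepSets_pow_three_le G Set.finite_univ

end MoonMoser

section Sinks

lemma exists_reflTransGen_forall_reflTransGen {α : Type*} [Finite α] (r : α → α → Prop) (a : α) :
    ∃ z, ReflTransGen r a z ∧ ∀ b, ReflTransGen r z b → ReflTransGen r b z := by
  let _ : Preorder α :=
    { le := fun b c => ReflTransGen r c b
      le_refl := fun _ => .refl
      le_trans := fun _ _ _ hba hcb => hcb.trans hba }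
  obtain ⟨z, haz, hz⟩ := exists_minimal_le_of_wellFoundedLT (fun _ : α => True) a trivial
  exact ⟨z, haz, fun b hzb => hz.le_of_le trivial hzb⟩

variable {V : Type*} {D : Digraph V}

/-- The out-neighbourhood `N⁺(v)`. A loop does not make `v` an out-neighbour of itself, so that
`N⁺(v) = ∅` exactly when `{v}` is closed under arcs. -/
def outNbhd (D : Digraph V) (v : V) : Set V :=
  {w | D.Adj v w ∧ w ≠ v}

lemma isKnot_setOf_reflTransGen {z w : V}
    (hback : ∀ v, ReflTransGen D.Adj z v → ReflTransGen D.Adj v z) (hw : w ∈ outNbhd D z) :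
    IsKnot D {v | ReflTransGen D.Adj z v} := by
  refine ⟨⟨⟨z, .refl⟩, fun u hu v => ⟨fun hv => ?_, fun huv => hu.trans huv.1⟩⟩,
    ⟨w, .single hw.1, z, .refl, hw.2⟩, fun u hu v hv huv => hv (hu.tail huv)⟩
  exact ⟨(hback u hu).trans hv, (hback v hv).trans hu⟩

lemma IsKnot.mem_of_reflTransGen {K : Set V} (hK : IsKnot D K) {u v : V} (hu : u ∈ K)
    (huv : ReflTransGen D.Adj u v) : v ∈ K := by
  induction huv with
  | refl => exact hu
  | tail _ hbc hb => exact by_contra fun hc => hK.2.2 _ hb _ hc hbc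

lemma eq_of_reflTransGen_of_forall_eq {α : Type*} {r : α → α → Prop} {z w : α}
    (hz : ∀ a, r z a → a = z) (hzw : ReflTransGen r z w) : w = z := by
  induction hzw with
  | refl => rfl
  | tail _ hbc hb => exact hz _ (hb ▸ hbc)

lemma eq_of_adj_of_outNbhd_subset {S : Set V} {z w : V} (hz : outNbhd D z ⊆ S) (hzw : D.Adj z w)
    (hw : w ∉ S) : w = z :=
  by_contra fun hne => hw (hz ⟨hzw, hne⟩)

theorem isKnotFree_iff_forall_exists_outNbhd_eq_empty [Finite V] :
    IsKnotFree D ↔ ∀ v, ∃ z, outNbhd D z = ∅ ∧ ReflTransGen D.Adj v z := by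
  constructor
  · intro hD v
    obtain ⟨z, hvz, hback⟩ := exists_reflTransGen_forall_reflTransGen D.Adj v
    refine ⟨z, Set.eq_empty_of_forall_notMem fun w hw => ?_, hvz⟩
    exact hD _ (isKnot_setOf_reflTransGen hback hw)
  · intro hD K hK
    obtain ⟨u, hu⟩ := hK.1.1
    obtain ⟨z, hz, huz⟩ := hD u
    have hzK : z ∈ K := hK.mem_of_reflTransGen hu huz
    obtain ⟨w, hwK, hne⟩ := hK.2.1.exists_ne z
    refine hne (eq_of_reflTransGen_of_forall_eq (fun a hza => ?_) ((hK.1.2 z hzK w).1 hwK).1)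
    exact eq_of_adj_of_outNbhd_subset hz.subset hza (Set.notMem_empty a)

/-- `ReachesOff D S u v`: some directed walk of `D` from `u` to `v` avoids `S`, except perhaps at
its start `u`. For `u ∉ S` this is reachability in `D - S`, without the subtype of vertices. -/
def ReachesOff (D : Digraph V) (S : Set V) : V → V → Prop :=
  ReflTransGen fun a b => D.Adj a b ∧ b ∉ S

/-- The sinks of `D - S`, as vertices of `D`. -/
def sinks (D : Digraph V) (S : Set V) : Set V :=
  {z | z ∉ S ∧ outNbhd D z ⊆ S}

variable {S T : Set V} {u v y z : V}

lemma ReachesOff.anti (hTS : T ⊆ S) (h : ReachesOff D S u v) : ReachesOff D T u v :=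
  ReflTransGen.mono (fun _ _ hab => ⟨hab.1, fun hb => hab.2 (hTS hb)⟩) _ _ h

lemma ReachesOff.eq_of_mem_sinks (hy : y ∈ sinks D S) (h : ReachesOff D S y v) : v = y :=
  eq_of_reflTransGen_of_forall_eq
    (fun _ hya => eq_of_adj_of_outNbhd_subset hy.2 hya.1 hya.2) h

lemma ReachesOff.exists_reflTransGen_deleteVerts (h : ReachesOff D S u v) (hu : u ∉ S) :
    ∃ hv : v ∉ S, ReflTransGen (deleteVerts D S).Adj ⟨u, hu⟩ ⟨v, hv⟩ := by
  induction h with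
  | refl => exact ⟨hu, .refl⟩
  | tail _ hbc hb => exact ⟨hbc.2, hb.2.tail hbc.1⟩

lemma reflTransGen_deleteVerts_iff {u v : {v : V // v ∉ S}} :
    ReflTransGen (deleteVerts D S).Adj u v ↔ ReachesOff D S u v :=
  ⟨ReflTransGen.lift Subtype.val (fun _ b hab => ⟨hab, b.2⟩) u v,
    fun h => (h.exists_reflTransGen_deleteVerts u.2).2⟩

lemma outNbhd_deleteVerts_eq_empty_iff {z : {v : V // v ∉ S}} :
    outNbhd (deleteVerts D S) z = ∅ ↔ z.1 ∈ sinks D S := by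
  refine ⟨fun h => ⟨z.2, fun w hw => ?_⟩, fun hz => Set.eq_empty_of_forall_notMem fun w hw => ?_⟩
  · by_contra hwS
    exact h.subset (show ⟨w, hwS⟩ ∈ outNbhd (deleteVerts D S) z from
      ⟨hw.1, fun heq => hw.2 (congrArg Subtype.val heq)⟩)
  · exact hw.2 (Subtype.ext (eq_of_adj_of_outNbhd_subset hz.2 hw.1 w.2))

theorem isDeletionSet_iff_forall_exists_reachesOff [Finite V] :
    IsDeletionSet D S ↔ ∀ v ∉ S, ∃ z ∈ sinks D S, ReachesOff D S v z := by
  simp only [IsDeletionSet, isKnotFree_iff_forall_exists_outNbhd_eq_empty,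
    outNbhd_deleteVerts_eq_empty_iff, reflTransGen_deleteVerts_iff, Subtype.forall,
    Subtype.exists]
  exact forall₂_congr fun v _ => exists_congr fun z =>
    ⟨fun ⟨_, hz⟩ => hz, fun hz => ⟨hz.1.1, hz⟩⟩

end Sinks

section MinimalDeletionSets

variable {V : Type*} {D : Digraph V} {S : Set V} {u v w y z : V}

/-- The basin of `z`: the vertices that reach `z` in `D - N⁺(z)`. Once `N⁺(z)` is deleted, they need
no further deletion. -/
def basin (D : Digraph V) (z : V) : Set V :=
  {v | v ∉ outNbhd D z ∧ ReachesOff D (outNbhd D z) v z}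

/-- The conflict graph joins `u ≠ z` when turning one of them into a sink, by deleting its
out-neighbours, decides whether the other is deleted. -/
def conflictGraph (D : Digraph V) : SimpleGraph V :=
  SimpleGraph.fromRel fun u z => u ∈ outNbhd D z ∪ basin D z

lemma mem_sinks_sdiff_singleton (hz : z ∈ sinks D S) (hv : v ∉ outNbhd D z) :
    z ∈ sinks D (S \ {v}) :=
  ⟨fun h => hz.1 h.1, Set.subset_sdiff_singleton hz.2 hv⟩

variable [Finite V]

lemma isDeletionSet_sdiff_singleton (hS : IsDeletionSet D S)
    (hz : z ∈ sinks D (S \ {v})) (hvz : ReachesOff D (S \ {v}) v z) :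
    IsDeletionSet D (S \ {v}) := by
  rw [isDeletionSet_iff_forall_exists_reachesOff] at hS ⊢
  intro u hu
  by_cases huS : u ∈ S
  · obtain rfl : u = v := by_contra fun hne => hu ⟨huS, hne⟩
    exact ⟨z, hz, hvz⟩
  obtain ⟨y, hy, huy⟩ := hS u huS
  have huy' : ReachesOff D (S \ {v}) u y := huy.anti Set.sdiff_subset
  by_cases hvy : v ∈ outNbhd D y
  · exact ⟨z, hz, (huy'.tail ⟨hvy.1, fun h => h.2 rfl⟩).trans hvz⟩
  · exact ⟨y, mem_sinks_sdiff_singleton hy hvy, huy'⟩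

lemma mem_outNbhd_of_adj_of_reachesOff (hS : Minimal (IsDeletionSet D) S)
    (hz : z ∈ sinks D S) (hv : v ∈ S) (hvw : D.Adj v w) (hw : w ∉ S) (hwz : ReachesOff D S w z) :
    v ∈ outNbhd D z := by
  by_contra hvz
  have hreach : ReachesOff D (S \ {v}) v z :=
    (hwz.anti Set.sdiff_subset).head ⟨hvw, fun h => hw h.1⟩
  exact hS.notMem_of_prop_sdiff_singleton
    (isDeletionSet_sdiff_singleton hS.prop (mem_sinks_sdiff_singleton hz hvz) hreach) hv

lemma exists_adj_notMem (hS : Minimal (IsDeletionSet D) S) (hv : v ∈ S) : ∃ w ∉ S, D.Adj v w := by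
  by_contra! hno
  have hsink : v ∈ sinks D (S \ {v}) :=
    ⟨fun h => h.2 rfl, fun w hw => ⟨by_contra fun hwS => hno w hwS hw.1, hw.2⟩⟩
  exact hS.notMem_of_prop_sdiff_singleton
    (isDeletionSet_sdiff_singleton hS.prop hsink .refl) hv

theorem biUnion_outNbhd_sinks (hS : Minimal (IsDeletionSet D) S) :
    ⋃ z ∈ sinks D S, outNbhd D z = S := by
  refine Set.Subset.antisymm (Set.iUnion₂_subset fun z hz => hz.2) fun v hv => ?_
  obtain ⟨w, hw, hvw⟩ := exists_adj_notMem hS hv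
  obtain ⟨z, hz, hwz⟩ := isDeletionSet_iff_forall_exists_reachesOff.1 hS.prop w hw
  exact Set.mem_biUnion hz (mem_outNbhd_of_adj_of_reachesOff hS hz hv hvw hw hwz)

lemma injOn_sinks_minimalDeletionSets : Set.InjOn (sinks D) (minimalDeletionSets D) :=
  fun S hS T hT hST => by
    rw [← biUnion_outNbhd_sinks hS, ← biUnion_outNbhd_sinks hT, hST]

lemma notMem_and_reachesOff_of_mem_basin (hS : Minimal (IsDeletionSet D) S) (hz : z ∈ sinks D S)
    (hv : v ∈ basin D z) : v ∉ S ∧ ReachesOff D S v z := by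
  obtain ⟨hvN, hvz⟩ := hv
  induction hvz using ReflTransGen.head_induction_on with
  | refl => exact ⟨hz.1, .refl⟩
  | head hvw _ ih =>
    obtain ⟨hw, hwz⟩ := ih hvw.2
    exact ⟨fun hv => hvN (mem_outNbhd_of_adj_of_reachesOff hS hz hv hvw.1 hw hwz),
      hwz.head ⟨hvw.1, hw⟩⟩

lemma eq_of_mem_sinks_of_mem_outNbhd_union_basin (hS : Minimal (IsDeletionSet D) S)
    (hy : y ∈ sinks D S) (hz : z ∈ sinks D S) (h : y ∈ outNbhd D z ∪ basin D z) : y = z := by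
  rcases h with hyz | hyz
  · exact absurd (hz.2 hyz) hy.1
  · exact ((notMem_and_reachesOff_of_mem_basin hS hz hyz).2.eq_of_mem_sinks hy).symm

lemma exists_mem_sinks_mem_outNbhd_union_basin (hS : Minimal (IsDeletionSet D) S) (v : V) :
    ∃ z ∈ sinks D S, v ∈ outNbhd D z ∪ basin D z := by
  by_cases hv : v ∈ S
  · rw [← biUnion_outNbhd_sinks hS] at hv
    obtain ⟨z, hz, hvz⟩ := Set.mem_iUnion₂.1 hv
    exact ⟨z, hz, .inl hvz⟩
  · obtain ⟨z, hz, hvz⟩ := isDeletionSet_iff_forall_exists_reachesOff.1 hS.prop v hv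
    exact ⟨z, hz, .inr ⟨fun h => hv (hz.2 h), hvz.anti hz.2⟩⟩

theorem maximal_isIndepSet_sinks (hS : Minimal (IsDeletionSet D) S) :
    Maximal (conflictGraph D).IsIndepSet (sinks D S) := by
  refine maximal_isIndepSet_of_forall_exists_adj (fun y hy z hz hne hyz => ?_) fun v hv => ?_
  · rcases hyz.2 with h | h
    · exact hne (eq_of_mem_sinks_of_mem_outNbhd_union_basin hS hy hz h)
    · exact hne (eq_of_mem_sinks_of_mem_outNbhd_union_basin hS hz hy h).symm
  · obtain ⟨z, hz, hvz⟩ := exists_mem_sinks_mem_outNbhd_union_basin hS v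
    exact ⟨z, hz, fun heq => hv (heq ▸ hz), .inl hvz⟩

lemma ncard_minimalDeletionSets_le_ncard_maximal_isIndepSet (D : Digraph V) :
    (minimalDeletionSets D).ncard ≤ {I | Maximal (conflictGraph D).IsIndepSet I}.ncard :=
  Set.ncard_le_ncard_of_injOn (sinks D) (fun _ hS => maximal_isIndepSet_sinks hS)
    injOn_sinks_minimalDeletionSets

end MinimalDeletionSets

lemma natCast_le_pow_of_pow_three_le_three_pow {m n : ℕ} (h : m ^ 3 ≤ 3 ^ n) :
    (m : ℝ) ≤ 1.4549 ^ n := by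
  refine le_of_pow_le_pow_left₀ three_ne_zero (by positivity) ?_
  calc (m : ℝ) ^ 3 ≤ 3 ^ n := by exact_mod_cast h
    _ ≤ (1.4549 ^ 3) ^ n := by gcongr; norm_num
    _ = (1.4549 ^ n) ^ 3 := pow_right_comm _ _ _

end KnotFree

theorem mainTheorem2_general {V : Type*} [Finite V] (D : Digraph V) :
    (KnotFree.minimalDeletionSets D).ncard ^ 3 ≤ 3 ^ Nat.card V :=
  (Nat.pow_le_pow_left
    (KnotFree.ncard_minimalDeletionSets_le_ncard_maximal_isIndepSet D) 3).trans
    (KnotFree.ncard_maximal_isIndepSet_pow_three_le (KnotFree.conflictGraph D))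

theorem mainTheorem2 :
    ∃ p : Polynomial ℝ, ∀ (V : Type*) [Fintype V] (D : Digraph V),
      ((KnotFree.minimalDeletionSets D).ncard : ℝ) ≤
        p.eval (Fintype.card V : ℝ) * (1.4549 : ℝ) ^ Fintype.card V := by
  refine ⟨1, fun V _ D => ?_⟩
  simpa using KnotFree.natCast_le_pow_of_pow_three_le_three_pow (mainTheorem2_general D)
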